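/- **Setting.** A single batch of $n$ packets contends for a slotted channel. A backoff algorithm runs through contention windows $i=0,1,2,\dots$ with $w_0,w_1,w_2,\dots\ge 1$ slots. In window $i$, every packet that has not yet succeeded transmits in one slot of the window, chosen uniformly at random from its $w_i$ slots, independently of all other choices. A packet that is alone in its slot succeeds and leaves; all other packets continue with window $i+1$. A collision is a slot in which at least two packets transmit, and the number of collisions of an execution is the total number of such slots over all windows. Write $\lg=\log_2$. Log-Backoff is either of the following two window schedules: 1. (doubling version) $W$ runs through $1,2,4,8,\dots$, and a window with $W$ slots is executed $\lg W$ times in succession (once if $W=1$), so the numbers of slots are $1,2,4,4,8,8,8,\dots$; 2. (monotone version) $W_0=1$ and $W_{i+1}=(1+r_i)W_i$ with $r_i=1/\lg W_i$ (and $r_0=1$, since $\lg W_0=0$), and window $i$ has $\lceil W_i\rceil$ slots. **Claim.** For a single batch of $n$ packets, Log-Backoff (in either version) experiences $\Omega\!\left(\frac{n\lg n}{\lg\lg n}\right)$ collisions with high probability. That is, for each version there is a constant $C>0$ such that for every constant $c>1$ and all sufficiently large $n$, $$\Pr\left[\#\text{collisions}\ \ge\ C\,\frac{n\lg n}{\lg\lg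 n}\right]\ \ge\ 1-\frac1{n^{c}} .$$ -/

import Mathlib

open MeasureTheory ProbabilityTheory Filter
open scoped ENNReal

namespace LogBackoff

/-! ### Executing a backoff schedule on a single batch

A schedule `w : ℕ → ℕ+` gives the number of slots of the successive contention windows. -/

/-- All slot choices for `n` packets: in window `i`, packet `p` picks the slot `x i p`. The choice
of a packet that has already succeeded is never used. -/
abbrev Choices (w : ℕ → ℕ+) (n : ℕ) : Type :=
  (i : ℕ) → Fin n → Fin (w i : ℕ)

/-- The law of the choices: independent over windows and packets, and uniform over the slots of
the window. -/
noncomputable def choiceLaw (w : ℕ → ℕ+) (n : ℕ) : Measure (Choices w n) :=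
  Measure.infinitePi fun i : ℕ =>
    Measure.pi fun _ : Fin n => uniformOn (Set.univ : Set (Fin (w i : ℕ)))

/-- The packets that have not succeeded before window `i`. An unfinished packet fails in
window `i` iff another unfinished packet picks the same slot. -/
def active {w : ℕ → ℕ+} {n : ℕ} (x : Choices w n) : ℕ → Finset (Fin n)
  | 0 => Finset.univ
  | i + 1 => (active x i).filter fun p => ∃ q ∈ active x i, q ≠ p ∧ x i q = x i p

/-- The number of collisions in window `i`: slots in which at least two unfinished packets
transmit. -/
def windowCollisions {w : ℕ → ℕ+} {n : ℕ} (x : Choices w n) (i : ℕ) : ℕ :=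
  (Finset.univ.filter fun s : Fin (w i : ℕ) =>
    2 ≤ ((active x i).filter fun p => x i p = s).card).card

/-- The number of collisions in the whole execution. Windows after the last success contribute
nothing, as no packet is active in them. -/
noncomputable def collisions {w : ℕ → ℕ+} {n : ℕ} (x : Choices w n) : ℝ≥0∞ :=
  ∑' i, (windowCollisions x i : ℝ≥0∞)

/-! ### The two specifications of Log-Backoff -/

/-- State of the doubling version: the current window size `W` (a power of two) and the number of
executions of a window of this size already completed. Windows of size `W` are executed `lg W`
times (once if `W = 1`), then `W` doubles. -/
def doublingState : ℕ → ℕ+ × ℕ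
  | 0 => (1, 0)
  | i + 1 =>
    if (doublingState i).2 + 1 < Nat.log 2 (doublingState i).1 then
      ((doublingState i).1, (doublingState i).2 + 1)
    else (2 * (doublingState i).1, 0)

/-- Window sizes `1, 2, 4, 4, 8, 8, 8, 16, …` of the doubling version of Log-Backoff. -/
def doublingSchedule (i : ℕ) : ℕ+ := (doublingState i).1

/-- The window size of the monotone version: start with `W = 1` and repeat
`W ← (1 + r) W` with `r = 1 / lg W`. The maximum only matters at `W = 1`, where `lg W = 0`
and `r = 1` is used; all later values of `W` are at least `2`. -/
noncomputable def monotoneSize : ℕ → ℝ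
  | 0 => 1
  | i + 1 => (1 + 1 / max 1 (Real.logb 2 (monotoneSize i))) * monotoneSize i

theorem monotoneSize_pos (i : ℕ) : 0 < monotoneSize i := by
  induction i with
  | zero => simp [monotoneSize]
  | succ i ih => rw [monotoneSize]; positivity

/-- The monotone version of Log-Backoff; a window of real size `W` has `⌈W⌉` slots. -/
noncomputable def monotoneSchedule (i : ℕ) : ℕ+ :=
  ⟨⌈monotoneSize i⌉₊, Nat.ceil_pos.2 (monotoneSize_pos i)⟩

end LogBackoff

/-!
Fix a window with `W` slots and a set `A` of active packets. The number of packets of `A` that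
land in a set `T` of slots has mean `|T| |A| / W`, so by Chernoff's bound it is at most `|T|` with
probability at most `(2 exp (-|A| / (2 W))) ^ |T|`. This is necessary for all slots of `T` to be
light (to receive at most one packet), and a union bound over `T` shows that, once
`exp (|A| / (4 W))` exceeds a multiple of `b`, more than a fraction `1 / (2 b)` of the slots is
light only with probability `exp (-Ω(|A| / b))`.

Run through `b = polylog n` windows with at most `M = n / Θ(lg lg n)` slots each. As long as half
of the packets are active, the load `|A| / W = Ω(lg lg n)` suffices for this bound, and since
successful packets occupy distinct light slots, at most `n / (2 b)` packets succeed per window.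
Hence half of the packets remain active throughout, and at least half of all slots are collisions.
Both versions of Log-Backoff spend `Ω(M lg M) = Ω(n lg n / lg lg n)` slots on their
polylogarithmically many windows of size at most `M`.
-/

namespace LogBackoff

section Probability

variable {Ω : Type*} [MeasurableSpace Ω] {μ : Measure Ω}

theorem mgf_indicator_one [IsProbabilityMeasure μ] {E : Set Ω} (hE : MeasurableSet E) (t : ℝ) :
    mgf (E.indicator fun _ => 1) μ t = 1 - (1 - Real.exp t) * μ.real E := by
  have hexp : (fun ω => Real.exp (t * E.indicator (fun _ => 1) ω))
      = fun ω => 1 - E.indicator (fun _ => 1 - Real.exp t) ω := by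
    ext ω
    by_cases hω : ω ∈ E <;> simp [hω]
  rw [mgf, hexp, integral_sub (integrable_const _) ((integrable_const _).indicator hE),
    integral_indicator_const _ hE]
  simp [mul_comm]

theorem measureReal_card_filter_mem_le_le {ι : Type*} {E : ι → Set Ω}
    [∀ ω, DecidablePred fun p => ω ∈ E p] (hind : iIndepSet E μ)
    (hE : ∀ p, MeasurableSet (E p)) (A : Finset ι) (t : ℕ) :
    μ.real {ω | (A.filter fun p => ω ∈ E p).card ≤ t}
      ≤ 2 ^ t * Real.exp (-(∑ p ∈ A, μ.real (E p)) / 2) := by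
  have := hind.isProbabilityMeasure
  let X : ι → Ω → ℝ := fun p => (E p).indicator fun _ => 1
  have hX (p : ι) : Measurable (X p) := measurable_const.indicator (hE p)
  have hcard (ω : Ω) : ((A.filter fun p => ω ∈ E p).card : ℝ) = (∑ p ∈ A, X p) ω := by
    simp [X, Set.indicator_apply]
  have hlog : Real.exp (-Real.log 2) = 1 / 2 := by
    rw [Real.exp_neg, Real.exp_log two_pos, one_div]
  have hint : Integrable (fun ω => Real.exp (-Real.log 2 * (∑ p ∈ A, X p) ω)) μ := by
    refine Integrable.of_bound (by fun_prop) 1 (ae_of_all _ fun ω => ?_)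
    rw [Real.norm_of_nonneg (Real.exp_pos _).le, Real.exp_le_one_iff, ← hcard]
    exact mul_nonpos_of_nonpos_of_nonneg (by simp [Real.log_nonneg]) (Nat.cast_nonneg _)
  have hmgf (p : ι) : mgf (X p) μ (-Real.log 2) ≤ Real.exp (-μ.real (E p) / 2) := by
    rw [mgf_indicator_one (hE p), hlog]
    linarith [Real.add_one_le_exp (-μ.real (E p) / 2)]
  calc μ.real {ω | (A.filter fun p => ω ∈ E p).card ≤ t}
      = μ.real {ω | (∑ p ∈ A, X p) ω ≤ t} := by simp only [← hcard, Nat.cast_le]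
    _ ≤ Real.exp (-(-Real.log 2) * t) * mgf (∑ p ∈ A, X p) μ (-Real.log 2) :=
        measure_le_le_exp_mul_mgf _ (by simp [Real.log_nonneg]) hint
    _ = 2 ^ t * ∏ p ∈ A, mgf (X p) μ (-Real.log 2) := by
        rw [hind.iIndepFun_indicator.mgf_sum hX, neg_neg, Real.exp_mul, Real.exp_log two_pos,
          Real.rpow_natCast]
    _ ≤ 2 ^ t * ∏ p ∈ A, Real.exp (-μ.real (E p) / 2) := by
        gcongr with p
        · exact fun p _ => mgf_nonneg
        · exact hmgf p
    _ = 2 ^ t * Real.exp (-(∑ p ∈ A, μ.real (E p)) / 2) := by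
        rw [← Real.exp_sum, ← Finset.sum_div, Finset.sum_neg_distrib]

theorem measure_prodMk_mem_le_of_indepFun {α β : Type*} [MeasurableSpace α] [MeasurableSpace β]
    [IsProbabilityMeasure μ] {X : Ω → α} {Y : Ω → β} (hXY : IndepFun X Y μ) (hX : Measurable X)
    (hY : Measurable Y) {S : Set (α × β)} (hS : MeasurableSet S) {ε : ℝ≥0∞}
    (hε : ∀ a, μ {ω | (a, Y ω) ∈ S} ≤ ε) : μ {ω | (X ω, Y ω) ∈ S} ≤ ε := by
  have := Measure.isProbabilityMeasure_map (μ := μ) hX.aemeasurable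
  calc μ {ω | (X ω, Y ω) ∈ S}
      = μ.map (fun ω => (X ω, Y ω)) S := (Measure.map_apply (hX.prodMk hY) hS).symm
    _ = ∫⁻ a, μ {ω | (a, Y ω) ∈ S} ∂μ.map X := by
        rw [hXY.map_prod_eq_prod_map_map hX.aemeasurable hY.aemeasurable, Measure.prod_apply hS]
        exact lintegral_congr fun a => Measure.map_apply hY (measurable_prodMk_left hS)
    _ ≤ ∫⁻ _, ε ∂μ.map X := lintegral_mono hε
    _ = ε := by simp

theorem infinitePi_eval_mem_le_of_dependsOn {ι β : Type*} {α : ι → Type*} [Nonempty β]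
    [∀ i, Countable (α i)] [∀ i, MeasurableSpace (α i)] [∀ i, MeasurableSingletonClass (α i)]
    (P : (i : ι) → Measure (α i)) [∀ i, IsProbabilityMeasure (P i)] {s : Finset ι} {i : ι}
    (hi : i ∉ s) {F : ((i : ι) → α i) → β} (hF : DependsOn F s) (E : β → Set (α i)) {ε : ℝ≥0∞}
    (hε : ∀ b, P i (E b) ≤ ε) : Measure.infinitePi P {x | x i ∈ E (F x)} ≤ ε := by
  obtain ⟨G, rfl⟩ := dependsOn_iff_exists_comp.1 hF
  have hind : IndepFun (fun (x : (i : ι) → α i) (j : s) => x j) (fun x => x i)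
      (Measure.infinitePi P) :=
    ((iIndepFun_infinitePi (X := fun _ a => a) fun _ => measurable_id).indepFun_finset s {i}
      (by simpa using hi) measurable_pi_apply).comp measurable_id
      (measurable_pi_apply ⟨i, Finset.mem_singleton_self i⟩)
  refine measure_prodMk_mem_le_of_indepFun hind (by fun_prop) (measurable_pi_apply i)
    (S := {z | z.2 ∈ E (G z.1)}) (Set.to_countable _).measurableSet fun y => ?_
  exact ((measurePreserving_eval_infinitePi P i).measure_preimage
    (s := E (G y)) (Set.to_countable _).measurableSet.nullMeasurableSet).trans_le (hε (G y))

end Probability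

instance isProbabilityMeasure_uniformOn_univ {σ : Type*} [Finite σ] [Nonempty σ]
    [MeasurableSpace σ] [MeasurableSingletonClass σ] :
    IsProbabilityMeasure (uniformOn (Set.univ : Set σ)) :=
  isProbabilityMeasure_uniformOn Set.finite_univ Set.univ_nonempty

section Window

variable {ι σ : Type*} [Fintype σ] [DecidableEq σ]

/-- The slots of a window in which at most one packet of `A` transmits when packet `p` picks slot
`f p`; these are the slots without a collision among the packets of `A`. -/
def lightSlots (A : Finset ι) (f : ι → σ) : Finset σ :=
  Finset.univ.filter fun s => (A.filter fun p => f p = s).card ≤ 1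

theorem card_filter_mem_le_of_subset_lightSlots {A : Finset ι} {f : ι → σ} {T : Finset σ}
    (hT : T ⊆ lightSlots A f) : (A.filter fun p => f p ∈ T).card ≤ T.card := by
  rw [← one_mul T.card]
  refine Finset.card_le_mul_card_image_of_maps_to (f := f)
    (fun p (hp : p ∈ A.filter fun p => f p ∈ T) => (Finset.mem_filter.1 hp).2) 1 fun s hs => ?_
  refine (Finset.card_le_card ?_).trans (Finset.mem_filter.1 (hT hs)).2
  gcongr
  exact Finset.filter_subset _ A

section Uniform
variable [Fintype ι] [Nonempty σ] [MeasurableSpace σ] [MeasurableSingletonClass σ]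

theorem measureReal_subset_lightSlots_le (A : Finset ι) (T : Finset σ) :
    (Measure.pi fun _ : ι => uniformOn (Set.univ : Set σ)).real {f | T ⊆ lightSlots A f}
      ≤ (2 * Real.exp (-(A.card / (2 * Fintype.card σ)))) ^ T.card := by
  set ν := Measure.pi fun _ : ι => uniformOn (Set.univ : Set σ)
  let E (p : ι) : Set (ι → σ) := {f | f p ∈ T}
  have hind : iIndepSet E ν := by
    rw [iIndepSet_iff_meas_biInter fun p => (Set.to_countable _).measurableSet]
    exact fun s => (iIndepFun_pi (μ := fun _ : ι => uniformOn (Set.univ : Set σ))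
      (X := fun _ a => a) fun _ => aemeasurable_id).measure_inter_preimage_eq_mul s
        (sets := fun _ => T) fun p _ => T.measurableSet
  have hE (p : ι) : ν.real (E p) = T.card / Fintype.card σ := by
    have h := (measurePreserving_eval (fun _ : ι => uniformOn (Set.univ : Set σ))
      p).measureReal_preimage (s := T) T.measurableSet.nullMeasurableSet
    rw [measureReal_def (uniformOn _), uniformOn_univ] at h
    exact h.trans (by simp)
  calc ν.real {f | T ⊆ lightSlots A f}
      ≤ ν.real {f | (A.filter fun p => f ∈ E p).card ≤ T.card} :=
        measureReal_mono fun f hf => card_filter_mem_le_of_subset_lightSlots hf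
    _ ≤ 2 ^ T.card * Real.exp (-(∑ p ∈ A, ν.real (E p)) / 2) :=
        measureReal_card_filter_mem_le_le hind (fun p => (Set.to_countable _).measurableSet) A _
    _ = (2 * Real.exp (-(A.card / (2 * Fintype.card σ)))) ^ T.card := by
        rw [mul_pow, ← Real.exp_nat_mul]
        simp only [hE, Finset.sum_const, nsmul_eq_mul]
        ring_nf

theorem measureReal_le_card_lightSlots_le (A : Finset ι) (t : ℕ) :
    (Measure.pi fun _ : ι => uniformOn (Set.univ : Set σ)).real {f | t ≤ (lightSlots A f).card}
      ≤ (Fintype.card σ).choose t * (2 * Real.exp (-(A.card / (2 * Fintype.card σ)))) ^ t := by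
  set ν := Measure.pi fun _ : ι => uniformOn (Set.univ : Set σ)
  have hcover : {f : ι → σ | t ≤ (lightSlots A f).card}
      ⊆ ⋃ T ∈ Finset.univ.powersetCard t, {f | T ⊆ lightSlots A f} := by
    intro f hf
    obtain ⟨T, hT, hcard⟩ := Finset.exists_subset_card_eq (Set.mem_ofPred_eq ▸ hf)
    exact Set.mem_biUnion (Finset.mem_powersetCard.2 ⟨T.subset_univ, hcard⟩) hT
  calc ν.real {f | t ≤ (lightSlots A f).card}
      ≤ ∑ T ∈ Finset.univ.powersetCard t, ν.real {f | T ⊆ lightSlots A f} :=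
        (measureReal_mono hcover (measure_ne_top _ _)).trans (measureReal_biUnion_finset_le _ _)
    _ ≤ ∑ T ∈ (Finset.univ : Finset σ).powersetCard t,
          (2 * Real.exp (-(A.card / (2 * Fintype.card σ)))) ^ t := by
        refine Finset.sum_le_sum fun T hT => ?_
        rw [← (Finset.mem_powersetCard.1 hT).2]
        exact measureReal_subset_lightSlots_le A T
    _ = _ := by simp

theorem choose_le_exp_one_mul_div_pow (N t : ℕ) :
    (N.choose t : ℝ) ≤ (Real.exp 1 * N / t) ^ t := by
  calc (N.choose t : ℝ) ≤ N ^ t / t.factorial := Nat.choose_le_pow_div t N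
    _ = (N / t) ^ t * (t ^ t / t.factorial) := by
      rcases eq_or_ne t 0 with rfl | ht
      · simp
      · rw [div_pow]
        field_simp
    _ ≤ (N / t) ^ t * Real.exp t := by
      gcongr
      exact Real.pow_div_factorial_le_exp _ t.cast_nonneg t
    _ = (Real.exp 1 * N / t) ^ t := by rw [← Real.exp_one_pow, ← mul_pow]; ring

theorem measureReal_lt_card_lightSlots_le (A : Finset ι) {δ : ℝ} (hδ : 0 < δ)
    (hload : 2 * Real.exp 1 ≤ δ * Real.exp (A.card / (4 * Fintype.card σ))) :
    (Measure.pi fun _ : ι => uniformOn (Set.univ : Set σ)).real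
        {f | δ * Fintype.card σ < (lightSlots A f).card}
      ≤ Real.exp (-(δ * A.card / 4)) := by
  set W := (Fintype.card σ : ℝ)
  have hW : 0 < W := by positivity
  set a : ℝ := A.card / (4 * W) with ha
  set t : ℕ := ⌊δ * W⌋₊ + 1
  have ht : δ * W < t := by exact_mod_cast Nat.lt_floor_add_one (δ * W)
  have htW : W / t ≤ 1 / δ := by
    rw [div_le_div_iff₀ ((by positivity : 0 ≤ δ * W).trans_lt ht) hδ]
    linarith
  have hbase : Real.exp 1 * W / t * (2 * Real.exp (-(A.card / (2 * W)))) ≤ Real.exp (-a) :=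
    calc Real.exp 1 * W / t * (2 * Real.exp (-(A.card / (2 * W))))
        = 2 * Real.exp 1 * (W / t) * (Real.exp (-a) * Real.exp (-a)) := by
          rw [← Real.exp_add, ha]; ring_nf
      _ ≤ δ * Real.exp a * (1 / δ) * (Real.exp (-a) * Real.exp (-a)) := by gcongr
      _ = Real.exp (-a) := by
          rw [Real.exp_neg]; field_simp
  calc _ ≤ (Measure.pi fun _ : ι => uniformOn (Set.univ : Set σ)).real
          {f | t ≤ (lightSlots A f).card} :=
        measureReal_mono fun f hf => Nat.succ_le_of_lt ((Nat.floor_lt (by positivity)).2 hf)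
    _ ≤ (Fintype.card σ).choose t * (2 * Real.exp (-(A.card / (2 * W)))) ^ t :=
        measureReal_le_card_lightSlots_le A t
    _ ≤ (Real.exp 1 * W / t) ^ t * (2 * Real.exp (-(A.card / (2 * W)))) ^ t := by
        gcongr
        exact choose_le_exp_one_mul_div_pow _ _
    _ ≤ Real.exp (-a) ^ t := by
        rw [← mul_pow]
        gcongr
    _ = Real.exp (-(t * a)) := by rw [← Real.exp_nat_mul, mul_neg]
    _ ≤ Real.exp (-(δ * W * a)) := by gcongr
    _ = Real.exp (-(δ * A.card / 4)) := by rw [ha]; field_simp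

end Uniform
end Window

section Execution

variable {w : ℕ → ℕ+} {n : ℕ}

instance isProbabilityMeasure_choiceLaw (w : ℕ → ℕ+) (n : ℕ) :
    IsProbabilityMeasure (choiceLaw w n) :=
  inferInstanceAs (IsProbabilityMeasure (Measure.infinitePi _))

theorem dependsOn_active (i : ℕ) :
    DependsOn (fun x : Choices w n => active x i) (Finset.range i) := by
  intro x y hxy
  induction i with
  | zero => rfl
  | succ i ih =>
    have hx : x i = y i := hxy i (by simp)
    have hactive : active x i = active y i :=
      ih fun j hj => hxy j (Finset.range_subset_range.2 i.le_succ hj)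
    simp only [active, hx, hactive]

theorem card_lightSlots_add_windowCollisions (x : Choices w n) (i : ℕ) :
    (lightSlots (active x i) (x i)).card + windowCollisions x i = w i := by
  have h := Finset.card_filter_add_card_filter_not (s := (Finset.univ : Finset (Fin (w i : ℕ))))
    fun s => ((active x i).filter fun p => x i p = s).card ≤ 1
  simp only [not_le, Finset.card_univ, Fintype.card_fin] at h
  exact h

/-- The packets that succeed in window `i` occupy distinct light slots. -/
theorem card_active_le_card_active_succ_add (x : Choices w n) (i : ℕ) :
    (active x i).card ≤ (active x (i + 1)).card + (lightSlots (active x i) (x i)).card := by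
  rw [active, ← Finset.card_filter_add_card_filter_not (s := active x i)
    fun p => ∃ q ∈ active x i, q ≠ p ∧ x i q = x i p]
  gcongr
  have halone : ∀ p ∈ (active x i).filter fun p => ¬ ∃ q ∈ active x i, q ≠ p ∧ x i q = x i p,
      ∀ q ∈ active x i, x i q = x i p → q = p := by
    intro p hp q hq hqp
    by_contra hne
    exact (Finset.mem_filter.1 hp).2 ⟨q, hq, hne, hqp⟩
  refine Finset.card_le_card_of_injOn (x i) (fun p hp => ?_)
    fun p hp q hq hpq => halone q hq p (Finset.mem_filter.1 hp).1 hpq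
  refine Finset.mem_filter.2 ⟨Finset.mem_univ _, Finset.card_le_one.2 fun q hq r hr => ?_⟩
  simp only [Finset.mem_filter] at hq hr
  rw [halone p hp q hq.1 hq.2, halone p hp r hr.1 hr.2]

/-- Window `i` is *wasted* in a run through `b` windows if at least half of the packets are active
in it and yet more than a fraction `1 / (2 * b)` of its slots is light. At most that fraction of
the packets succeeds in a window that is not wasted, so that `b` windows without waste leave half
of the packets active. -/
def IsWasted (x : Choices w n) (b i : ℕ) : Prop :=
  (n : ℝ) / 2 ≤ (active x i).card ∧
    1 / (2 * b) * (w i : ℕ) < ((lightSlots (active x i) (x i)).card : ℝ)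

theorem half_le_card_active_of_not_isWasted {x : Choices w n} {b : ℕ}
    (hw : ∀ i < b, (w i : ℕ) ≤ n) (hx : ∀ i < b, ¬ IsWasted x b i) {i : ℕ} (hi : i < b) :
    (n : ℝ) / 2 ≤ (active x i).card := by
  have hb : (0 : ℝ) < b := by exact_mod_cast i.zero_le.trans_lt hi
  have hhalf {j : ℕ} (hj : j < b) : (n : ℝ) / 2 ≤ n - j * (1 / (2 * b) * n) := by
    calc (n : ℝ) / 2 = n - b * (1 / (2 * b) * n) := by field_simp; norm_num
      _ ≤ n - j * (1 / (2 * b) * n) := by gcongr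
  suffices hlinear : (n : ℝ) - i * (1 / (2 * b) * n) ≤ (active x i).card from
    (hhalf hi).trans hlinear
  induction i with
  | zero => simp [active]
  | succ j ih =>
    have hj : j < b := j.lt_succ_self.trans hi
    have hlight : ((lightSlots (active x j) (x j)).card : ℝ) ≤ 1 / (2 * b) * (w j : ℕ) :=
      not_lt.1 fun h => hx j hj ⟨(hhalf hj).trans (ih hj), h⟩
    have hwj : 1 / (2 * b) * ((w j : ℕ) : ℝ) ≤ 1 / (2 * b) * n := by
      gcongr
      exact hw j hj
    have hstep : ((active x j).card : ℝ) ≤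
        (active x (j + 1)).card + (lightSlots (active x j) (x j)).card := by
      exact_mod_cast card_active_le_card_active_succ_add x j
    push_cast
    linarith [ih hj]

theorem half_le_windowCollisions_of_not_isWasted {x : Choices w n} {b i : ℕ} (hb : 0 < b)
    (hactive : (n : ℝ) / 2 ≤ (active x i).card) (hx : ¬ IsWasted x b i) :
    ((w i : ℕ) : ℝ) / 2 ≤ windowCollisions x i := by
  have hlight : ((lightSlots (active x i) (x i)).card : ℝ) ≤ 1 / (2 * b) * (w i : ℕ) :=
    not_lt.1 fun h => hx ⟨hactive, h⟩
  have hfrac : 1 / (2 * b) * ((w i : ℕ) : ℝ) ≤ 1 / 2 * (w i : ℕ) := by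
    gcongr
    exact le_mul_of_one_le_right two_pos.le (by exact_mod_cast hb)
  have hsplit : ((lightSlots (active x i) (x i)).card : ℝ) + windowCollisions x i = (w i : ℕ) := by
    exact_mod_cast card_lightSlots_add_windowCollisions x i
  linarith

theorem half_sum_le_collisions_of_not_isWasted {x : Choices w n} {b : ℕ}
    (hw : ∀ i < b, (w i : ℕ) ≤ n) (hx : ∀ i < b, ¬ IsWasted x b i) :
    ENNReal.ofReal ((∑ i ∈ Finset.range b, ((w i : ℕ) : ℝ)) / 2) ≤ collisions x := by
  calc ENNReal.ofReal ((∑ i ∈ Finset.range b, ((w i : ℕ) : ℝ)) / 2)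
      ≤ ENNReal.ofReal (∑ i ∈ Finset.range b, windowCollisions x i : ℕ) := by
        refine ENNReal.ofReal_le_ofReal ?_
        rw [Finset.sum_div, Nat.cast_sum]
        refine Finset.sum_le_sum fun i hi => ?_
        have hib := Finset.mem_range.1 hi
        exact half_le_windowCollisions_of_not_isWasted (i.zero_le.trans_lt hib)
          (half_le_card_active_of_not_isWasted hw hx hib) (hx i hib)
    _ = ∑ i ∈ Finset.range b, (windowCollisions x i : ℝ≥0∞) := by
        rw [ENNReal.ofReal_natCast, Nat.cast_sum]
    _ ≤ collisions x := ENNReal.sum_le_tsum _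

theorem choiceLaw_real_isWasted_le {b i : ℕ} (hb : 0 < b)
    (hload : 4 * Real.exp 1 * b ≤ Real.exp (n / (8 * (w i : ℕ)))) :
    (choiceLaw w n).real {x | IsWasted x b i} ≤ Real.exp (-(n / (16 * b))) := by
  let E (A : Finset (Fin n)) : Set (Fin n → Fin (w i)) :=
    {f | (n : ℝ) / 2 ≤ A.card ∧ 1 / (2 * b) * (w i : ℕ) < ((lightSlots A f).card : ℝ)}
  refine ENNReal.toReal_le_of_le_ofReal (Real.exp_pos _).le
    (infinitePi_eval_mem_le_of_dependsOn _ Finset.notMem_range_self (dependsOn_active i) E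
      fun A => ?_)
  by_cases hA : (n : ℝ) / 2 ≤ A.card
  · have hloadA : 2 * Real.exp 1 ≤
        1 / (2 * b) * Real.exp (A.card / (4 * Fintype.card (Fin (w i)))) := by
      rw [Fintype.card_fin]
      calc 2 * Real.exp 1 = 1 / (2 * b) * (4 * Real.exp 1 * b) := by field_simp; norm_num
        _ ≤ 1 / (2 * b) * Real.exp (n / 2 / (4 * (w i : ℕ))) := by
          gcongr
          refine hload.trans_eq (congrArg Real.exp ?_)
          field_simp; ring
        _ ≤ 1 / (2 * b) * Real.exp (A.card / (4 * (w i : ℕ))) := by gcongr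
    rw [ENNReal.le_ofReal_iff_toReal_le (measure_ne_top _ _) (Real.exp_pos _).le]
    calc _ ≤ (Measure.pi fun _ : Fin n => uniformOn (Set.univ : Set (Fin (w i)))).real
            {f | 1 / (2 * b) * Fintype.card (Fin (w i)) < ((lightSlots A f).card : ℝ)} := by
          rw [Fintype.card_fin]
          exact measureReal_mono fun f hf => hf.2
      _ ≤ Real.exp (-(1 / (2 * b) * A.card / 4)) :=
          measureReal_lt_card_lightSlots_le A (by positivity) hloadA
      _ ≤ Real.exp (-(1 / (2 * b) * (n / 2) / 4)) := by gcongr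
      _ = Real.exp (-(n / (16 * b))) := by
          congr 2; field_simp; ring
  · simp [E, hA]

theorem one_sub_le_choiceLaw_real_half_sum_le_collisions {b M : ℕ} (hMn : M ≤ n)
    (hw : ∀ i < b, (w i : ℕ) ≤ M)
    (hload : 4 * Real.exp 1 * b ≤ Real.exp (n / (8 * M))) :
    1 - b * Real.exp (-(n / (16 * b))) ≤ (choiceLaw w n).real
      {x | ENNReal.ofReal ((∑ i ∈ Finset.range b, ((w i : ℕ) : ℝ)) / 2) ≤ collisions x} := by
  set many : Set (Choices w n) :=
    {x | ENNReal.ofReal ((∑ i ∈ Finset.range b, ((w i : ℕ) : ℝ)) / 2) ≤ collisions x}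
  set wasted : Set (Choices w n) := ⋃ i ∈ Finset.range b, {x | IsWasted x b i}
  have hcover : Set.univ ⊆ many ∪ wasted := by
    refine fun x _ => or_iff_not_imp_right.2 fun hx => ?_
    simp only [wasted, Set.mem_iUnion, Finset.mem_range, not_exists] at hx
    exact half_sum_le_collisions_of_not_isWasted (fun i hi => (hw i hi).trans hMn) hx
  have hwasted : (choiceLaw w n).real wasted ≤ b * Real.exp (-(n / (16 * b))) := by
    calc (choiceLaw w n).real wasted
        ≤ ∑ i ∈ Finset.range b, (choiceLaw w n).real {x | IsWasted x b i} :=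
          measureReal_biUnion_finset_le _ _
      _ ≤ ∑ _i ∈ Finset.range b, Real.exp (-(n / (16 * b))) := by
          refine Finset.sum_le_sum fun i hi => ?_
          rw [Finset.mem_range] at hi
          refine choiceLaw_real_isWasted_le (i.zero_le.trans_lt hi) (hload.trans ?_)
          gcongr
          exact hw i hi
      _ = b * Real.exp (-(n / (16 * b))) := by simp
  have hone : 1 ≤ (choiceLaw w n).real many + (choiceLaw w n).real wasted := by
    rw [← probReal_univ (μ := choiceLaw w n)]
    exact (measureReal_mono hcover (measure_ne_top _ _)).trans (measureReal_union_le _ _)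
  linarith

end Execution

/-- A schedule grows slowly if, for every large `M`, it opens with windows of at most `M` slots
that are polylogarithmically many in `M` and have `Ω(M lg M)` slots in all. Constant growth factors
would only give `O(M)` slots. -/
def GrowsSlowly (w : ℕ → ℕ+) : Prop :=
  ∃ (d K : ℕ) (κ : ℝ), 0 < κ ∧ ∀ᶠ M : ℕ in atTop, ∃ b : ℕ, (∀ i < b, (w i : ℕ) ≤ M) ∧
    b ≤ K * Real.logb 2 M ^ d ∧ κ * (M * Real.logb 2 M) ≤ ∑ i ∈ Finset.range b, ((w i : ℕ) : ℝ)

section Doubling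

theorem doublingState_one_add_choose_two_add {j k : ℕ} (hk : k < j) :
    doublingState (1 + j.choose 2 + k) = (2 ^ j, k) := by
  induction j generalizing k with
  | zero => exact absurd hk k.not_lt_zero
  | succ j ihj =>
    induction k with
    | zero =>
      cases j with
      | zero => simp [doublingState]
      | succ j =>
        have hindex : 1 + (j + 2).choose 2 + 0 = 1 + (j + 1).choose 2 + j + 1 := by
          rw [Nat.choose_succ_succ' (j + 1) 1, Nat.choose_one_right]
          lia
        rw [hindex, doublingState, ihj j.lt_succ_self, if_neg (by simp), pow_succ' _ (j + 1)]
    | succ k ihk =>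
      rw [← add_assoc, doublingState, ihk (k.lt_succ_self.trans hk)]
      simp [hk]

theorem doublingSchedule_one_add_choose_two_add {j k : ℕ} (hk : k < j) :
    (doublingSchedule (1 + j.choose 2 + k) : ℕ) = 2 ^ j := by
  simp [doublingSchedule, doublingState_one_add_choose_two_add hk]

theorem monotone_doublingSchedule : Monotone doublingSchedule := by
  refine monotone_nat_of_le_succ fun i => ?_
  rw [doublingSchedule, doublingSchedule, doublingState]
  split_ifs
  · exact le_rfl
  · exact le_mul_of_one_le_left' one_le

theorem doublingSchedule_le_of_lt_one_add_choose_two {i j : ℕ} (hi : i < 1 + (j + 1).choose 2) :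
    (doublingSchedule i : ℕ) ≤ 2 ^ j := by
  rcases j.eq_zero_or_pos with rfl | hj
  · have hi0 : i = 0 := by simpa using hi
    simp [hi0, doublingSchedule, doublingState]
  · rw [Nat.choose_succ_succ' j 1, Nat.choose_one_right] at hi
    rw [← doublingSchedule_one_add_choose_two_add (Nat.sub_lt hj one_pos)]
    exact_mod_cast monotone_doublingSchedule (by lia)

theorem sum_doublingSchedule_add (j : ℕ) :
    ∑ i ∈ Finset.range (1 + (j + 1).choose 2), (doublingSchedule i : ℕ) + 2 ^ (j + 1)
      = j * 2 ^ (j + 1) + 3 := by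
  induction j with
  | zero => simp [doublingSchedule, doublingState]
  | succ j ih =>
    have hround : ∑ k ∈ Finset.range (j + 1),
        (doublingSchedule (1 + (j + 1).choose 2 + k) : ℕ) = (j + 1) * 2 ^ (j + 1) := by
      rw [Finset.sum_congr rfl fun k hk =>
        doublingSchedule_one_add_choose_two_add (Finset.mem_range.1 hk)]
      simp
    rw [Nat.choose_succ_succ' (j + 1) 1, Nat.choose_one_right, add_comm (j + 1), ← add_assoc,
      Finset.sum_range_add, hround, pow_succ 2 (j + 1)]
    linear_combination ih

theorem growsSlowly_doublingSchedule : GrowsSlowly doublingSchedule := by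
  refine ⟨2, 2, 1 / 3, by norm_num, (eventually_ge_atTop 4).mono fun M hM => ?_⟩
  have hM0 : M ≠ 0 := by lia
  set j := Nat.log 2 M
  have hj : 2 ≤ j := Nat.le_log_of_pow_le one_lt_two hM
  have hlower : 2 ^ j ≤ M := Nat.pow_log_le_self 2 hM0
  have hupper : M < 2 ^ (j + 1) := Nat.lt_pow_succ_log_self one_lt_two M
  have hlg_lower : (j : ℝ) ≤ Real.logb 2 M := Real.natLog_le_logb M 2
  have hlg_upper : Real.logb 2 M ≤ j + 1 := by
    rw [Real.logb_le_iff_le_rpow one_lt_two (by positivity)]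
    exact_mod_cast hupper.le
  refine ⟨1 + (j + 1).choose 2,
    fun i hi => (doublingSchedule_le_of_lt_one_add_choose_two hi).trans hlower, ?_, ?_⟩
  · have hj' : (2 : ℝ) ≤ j := by exact_mod_cast hj
    calc ((1 + (j + 1).choose 2 : ℕ) : ℝ) = 1 + (j + 1) * j / 2 := by
          push_cast [Nat.cast_choose_two]; ring
      _ ≤ 2 * (j : ℝ) ^ 2 := by nlinarith
      _ ≤ 2 * Real.logb 2 M ^ 2 := by gcongr
  · have hj' : (2 : ℝ) ≤ j := by exact_mod_cast hj
    have hsum : ∑ i ∈ Finset.range (1 + (j + 1).choose 2), ((doublingSchedule i : ℕ) : ℝ)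
        + 2 ^ (j + 1) = j * 2 ^ (j + 1) + 3 := by
      exact_mod_cast sum_doublingSchedule_add j
    calc 1 / 3 * (M * Real.logb 2 M) ≤ 1 / 3 * (2 ^ (j + 1) * (j + 1)) := by
          gcongr
          · exact j.cast_nonneg.trans hlg_lower
          · exact_mod_cast hupper.le
      _ ≤ (j - 1) * 2 ^ (j + 1) := by
          nlinarith [pow_pos (two_pos (α := ℝ)) (j + 1)]
      _ ≤ _ := by linarith

end Doubling

section Monotone

/-- The growth rate `r` of the monotone version after window `i`. -/
noncomputable def monotoneRate (i : ℕ) : ℝ :=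
  1 / max 1 (Real.logb 2 (monotoneSize i))

theorem monotoneSize_succ (i : ℕ) :
    monotoneSize (i + 1) = (1 + monotoneRate i) * monotoneSize i := rfl

theorem monotoneRate_pos (i : ℕ) : 0 < monotoneRate i := by
  rw [monotoneRate]
  positivity

theorem monotoneRate_le_one (i : ℕ) : monotoneRate i ≤ 1 :=
  (div_le_one (by positivity)).2 (le_max_left 1 _)

theorem monotoneRate_mul_logb_le_one (i : ℕ) :
    monotoneRate i * Real.logb 2 (monotoneSize i) ≤ 1 := by
  rw [monotoneRate, one_div_mul_eq_div, div_le_one (by positivity)]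
  exact le_max_right 1 _

theorem logb_monotoneSize_succ (i : ℕ) : Real.logb 2 (monotoneSize (i + 1))
    = Real.logb 2 (monotoneSize i) + Real.logb 2 (1 + monotoneRate i) := by
  have hr := monotoneRate_pos i
  rw [monotoneSize_succ, Real.logb_mul (by positivity) (monotoneSize_pos i).ne', add_comm]

theorem one_le_monotoneSize (i : ℕ) : 1 ≤ monotoneSize i := by
  induction i with
  | zero => rfl
  | succ i ih =>
    rw [monotoneSize_succ]
    exact one_le_mul_of_one_le_of_one_le (by linarith [monotoneRate_pos i]) ih

theorem logb_monotoneSize_nonneg (i : ℕ) : 0 ≤ Real.logb 2 (monotoneSize i) :=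
  Real.logb_nonneg one_lt_two (one_le_monotoneSize i)

theorem le_logb_two_one_add {u : ℝ} (h0 : 0 ≤ u) (h1 : u ≤ 1) : u ≤ Real.logb 2 (1 + u) := by
  rw [Real.le_logb_iff_rpow_le one_lt_two (by linarith)]
  simpa [one_add_one_eq_two] using rpow_one_add_le_one_add_mul_self (s := 1) (by simp) h0 h1

theorem logb_two_one_add_le {u : ℝ} (h0 : 0 ≤ u) : Real.logb 2 (1 + u) ≤ 2 * u := by
  rw [Real.logb, div_le_iff₀ (Real.log_pos one_lt_two)]
  nlinarith [Real.log_two_gt_d9, Real.log_le_sub_one_of_pos (x := 1 + u) (by linarith)]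

theorem one_le_two_mul_rate_mul_logb_add_sq (i : ℕ) :
    1 ≤ 2 * monotoneRate i * Real.logb 2 (monotoneSize i) + monotoneRate i ^ 2 := by
  have hL := logb_monotoneSize_nonneg i
  rcases le_total (Real.logb 2 (monotoneSize i)) 1 with h | h
  · simp only [monotoneRate, max_eq_left h]
    linarith
  · have hrate : monotoneRate i * Real.logb 2 (monotoneSize i) = 1 := by
      rw [monotoneRate, max_eq_right h, one_div_mul_cancel (by positivity)]
    nlinarith [sq_nonneg (monotoneRate i)]

theorem natCast_le_logb_monotoneSize_sq (i : ℕ) :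
    (i : ℝ) ≤ Real.logb 2 (monotoneSize i) ^ 2 := by
  induction i with
  | zero => simp [monotoneSize]
  | succ i ih =>
    set L := Real.logb 2 (monotoneSize i)
    have hL : 0 ≤ L := logb_monotoneSize_nonneg i
    have hr := monotoneRate_pos i
    calc ((i + 1 : ℕ) : ℝ) ≤ L ^ 2 + (2 * monotoneRate i * L + monotoneRate i ^ 2) := by
          push_cast
          exact add_le_add ih (one_le_two_mul_rate_mul_logb_add_sq i)
      _ = (L + monotoneRate i) ^ 2 := by ring
      _ ≤ Real.logb 2 (monotoneSize (i + 1)) ^ 2 := by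
          rw [logb_monotoneSize_succ]
          gcongr
          exact le_logb_two_one_add hr.le (monotoneRate_le_one i)

theorem monotoneSize_mul_le_sum (i : ℕ) :
    monotoneSize i * (Real.logb 2 (monotoneSize i) - 4)
      ≤ ∑ t ∈ Finset.range i, monotoneSize t := by
  induction i with
  | zero => simp [monotoneSize]
  | succ i ih =>
    rw [Finset.sum_range_succ, logb_monotoneSize_succ, monotoneSize_succ]
    set L := Real.logb 2 (monotoneSize i)
    set r := monotoneRate i
    set V := monotoneSize i
    have hV : 0 < V := monotoneSize_pos i
    have hr : 0 < r := monotoneRate_pos i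
    have hr1 : r ≤ 1 := monotoneRate_le_one i
    have hrL : r * L ≤ 1 := monotoneRate_mul_logb_le_one i
    calc (1 + r) * V * (L + Real.logb 2 (1 + r) - 4)
        ≤ (1 + r) * V * (L + 2 * r - 4) := by
          gcongr
          exact logb_two_one_add_le hr.le
      _ = V * (L - 4) + V * (r * L - 2 * r * (1 - r)) := by ring
      _ ≤ V * (L - 4) + V * 1 := by
          gcongr
          nlinarith
      _ ≤ ∑ t ∈ Finset.range i, monotoneSize t + V := by linarith

theorem exists_monotoneSize_le_of_lt_and_lt (M : ℝ) : ∃ b : ℕ,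
    (∀ i < b, monotoneSize i ≤ M) ∧ b ≤ Real.logb 2 M ^ 2 + 1 ∧ M < monotoneSize b := by
  have hindex {i : ℕ} (hi : monotoneSize i ≤ M) : (i : ℝ) ≤ Real.logb 2 M ^ 2 := by
    refine (natCast_le_logb_monotoneSize_sq i).trans ?_
    have hL := logb_monotoneSize_nonneg i
    have hV := monotoneSize_pos i
    gcongr
    norm_num
  have hex : ∃ b, M < monotoneSize b := by
    obtain ⟨b, hb⟩ := exists_nat_gt (Real.logb 2 M ^ 2)
    exact ⟨b, not_le.1 fun h => hb.not_ge (hindex h)⟩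
  classical
  have hle : ∀ i < Nat.find hex, monotoneSize i ≤ M := fun i hi => not_lt.1 (Nat.find_min hex hi)
  refine ⟨Nat.find hex, hle, ?_, Nat.find_spec hex⟩
  cases hb : Nat.find hex with
  | zero => exact_mod_cast add_nonneg (sq_nonneg (Real.logb 2 M)) zero_le_one
  | succ i =>
    push_cast
    gcongr
    exact hindex (hle i (hb ▸ i.lt_succ_self))

theorem growsSlowly_monotoneSchedule : GrowsSlowly monotoneSchedule := by
  refine ⟨2, 2, 1 / 2, by norm_num, (eventually_ge_atTop (2 ^ 8)).mono fun M hM => ?_⟩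
  have hlg : 8 ≤ Real.logb 2 M := by
    rw [Real.le_logb_iff_rpow_le one_lt_two (by positivity)]
    exact_mod_cast hM
  obtain ⟨b, hle, hb, hlt⟩ := exists_monotoneSize_le_of_lt_and_lt M
  refine ⟨b, fun i hi => Nat.ceil_le.2 (hle i hi), by push_cast; nlinarith, ?_⟩
  calc 1 / 2 * (M * Real.logb 2 M) ≤ M * (Real.logb 2 M - 4) := by
        nlinarith [M.cast_nonneg (α := ℝ)]
    _ ≤ monotoneSize b * (Real.logb 2 (monotoneSize b) - 4) := by
        have hV := monotoneSize_pos b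
        gcongr
        · linarith
        · exact one_lt_two
    _ ≤ ∑ i ∈ Finset.range b, monotoneSize i := monotoneSize_mul_le_sum b
    _ ≤ ∑ i ∈ Finset.range b, ((monotoneSchedule i : ℕ) : ℝ) :=
        Finset.sum_le_sum fun i _ => Nat.le_ceil _

end Monotone

section Asymptotics

theorem log_le_logb_two {x : ℝ} (hx : 1 ≤ x) : Real.log x ≤ Real.logb 2 x :=
  le_div_self (Real.log_nonneg hx) (Real.log_pos one_lt_two)
    (by linarith [Real.log_two_lt_d9])

theorem tendsto_logb_two_natCast_atTop :
    Tendsto (fun n : ℕ => Real.logb 2 n) atTop atTop :=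
  (Real.tendsto_logb_atTop one_lt_two).comp tendsto_natCast_atTop_atTop

theorem eventually_mul_logb_two_pow_le (a : ℝ) (d : ℕ) :
    ∀ᶠ n : ℕ in atTop, a * Real.logb 2 n ^ d ≤ n := by
  have hlittle : (fun x : ℝ => a * Real.logb 2 x ^ d) =o[atTop] id := by
    simp only [Real.logb, div_pow, mul_div_assoc']
    simpa only [mul_div_right_comm] using
      (Real.isLittleO_pow_log_id_atTop (n := d)).const_mul_left (a / Real.log 2 ^ d)
  filter_upwards [tendsto_natCast_atTop_atTop.eventually (hlittle.bound one_pos)] with n hn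
  simpa using (le_abs_self _).trans hn

/-- The size up to which the windows are counted: a window with at most `windowBound d n` slots
receives so many packets that the load beats a union bound over `(lg n) ^ d` windows. -/
noncomputable def windowBound (d n : ℕ) : ℕ :=
  ⌊n / (8 * (d + 1) * Real.log (Real.logb 2 n))⌋₊

variable (d : ℕ)

theorem eventually_windowBound_le : ∀ᶠ n : ℕ in atTop, windowBound d n ≤ n := by
  filter_upwards [tendsto_logb_two_natCast_atTop.eventually_ge_atTop (Real.exp 1)] with n hl
  have hlog : 1 ≤ Real.log (Real.logb 2 n) :=
    (Real.le_log_iff_exp_le ((Real.exp_pos 1).trans_le hl)).2 hl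
  refine Nat.floor_le_of_le (div_le_self n.cast_nonneg ?_)
  nlinarith [d.cast_nonneg (α := ℝ)]

theorem eventually_le_windowBound : ∀ᶠ n : ℕ in atTop,
    n / (16 * (d + 1) * Real.log (Real.logb 2 n)) ≤ windowBound d n := by
  filter_upwards [tendsto_logb_two_natCast_atTop.eventually_gt_atTop 1,
    eventually_mul_logb_two_pow_le (8 * (d + 1)) 1] with n hl hn
  have hlog : 0 < Real.log (Real.logb 2 n) := Real.log_pos hl
  have hone : 1 ≤ n / (8 * (d + 1) * Real.log (Real.logb 2 n)) := by
    rw [one_le_div (by positivity)]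
    refine le_trans ?_ hn
    rw [pow_one]
    gcongr
    exact Real.log_le_self (one_pos.trans hl).le
  calc n / (16 * (d + 1) * Real.log (Real.logb 2 n))
      = n / (8 * (d + 1) * Real.log (Real.logb 2 n)) / 2 := by field_simp; ring
    _ ≤ windowBound d n := (Nat.div_two_lt_floor hone).le

theorem eventually_le_windowBound_sq : ∀ᶠ n : ℕ in atTop, n ≤ windowBound d n ^ 2 := by
  filter_upwards [tendsto_logb_two_natCast_atTop.eventually_gt_atTop 1,
    eventually_le_windowBound d, eventually_mul_logb_two_pow_le ((16 * (d + 1)) ^ 2) 2,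
    eventually_gt_atTop 0] with n hl hM hn hn0
  have hlog : 0 < Real.log (Real.logb 2 n) := Real.log_pos hl
  have hsq : (16 * (d + 1) * Real.log (Real.logb 2 n)) ^ 2 ≤ n := by
    refine le_trans ?_ hn
    rw [mul_pow]
    gcongr
    exact Real.log_le_self (one_pos.trans hl).le
  have hreal : (n : ℝ) ≤ windowBound d n ^ 2 := by
    calc (n : ℝ) = n ^ 2 / n := by field_simp
      _ ≤ n ^ 2 / (16 * (d + 1) * Real.log (Real.logb 2 n)) ^ 2 := by gcongr
      _ ≤ windowBound d n ^ 2 := by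
        rw [← div_pow]
        gcongr
  exact_mod_cast hreal

theorem tendsto_windowBound_atTop : Tendsto (windowBound d) atTop atTop := by
  refine tendsto_atTop.2 fun m => ?_
  filter_upwards [eventually_le_windowBound_sq d, eventually_ge_atTop (m ^ 2)] with n hn hm
  exact (Nat.pow_le_pow_iff_left two_ne_zero).1 (hm.trans hn)

theorem eventually_mul_logb_two_pow_le_exp (a : ℝ) : ∀ᶠ n : ℕ in atTop,
    a * Real.logb 2 n ^ d ≤ Real.exp (n / (8 * windowBound d n)) := by
  filter_upwards [tendsto_logb_two_natCast_atTop.eventually_gt_atTop 1,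
    tendsto_logb_two_natCast_atTop.eventually_ge_atTop a,
    (tendsto_windowBound_atTop d).eventually_gt_atTop 0] with n hl ha hM
  have hlog : 0 < Real.log (Real.logb 2 n) := Real.log_pos hl
  have hl0 : 0 < Real.logb 2 n := one_pos.trans hl
  have hfloor : (windowBound d n : ℝ) ≤ n / (8 * (d + 1) * Real.log (Real.logb 2 n)) :=
    Nat.floor_le (by positivity)
  have hexponent : (d + 1 : ℕ) * Real.log (Real.logb 2 n) ≤ n / (8 * windowBound d n) := by
    rw [le_div_iff₀ (by positivity)] at hfloor ⊢
    push_cast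
    linarith
  calc a * Real.logb 2 n ^ d ≤ Real.logb 2 n * Real.logb 2 n ^ d := by gcongr
    _ = Real.exp ((d + 1 : ℕ) * Real.log (Real.logb 2 n)) := by
        rw [Real.exp_nat_mul, Real.exp_log hl0, pow_succ']
    _ ≤ Real.exp (n / (8 * windowBound d n)) := Real.exp_le_exp.2 hexponent

theorem eventually_mul_logb_two_div_le : ∀ᶠ n : ℕ in atTop,
    n * Real.logb 2 n / Real.logb 2 (Real.logb 2 n)
      ≤ 32 * (d + 1) * (windowBound d n * Real.logb 2 (windowBound d n)) := by
  filter_upwards [tendsto_logb_two_natCast_atTop.eventually_gt_atTop 1,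
    eventually_le_windowBound d, eventually_le_windowBound_sq d, eventually_gt_atTop 0]
    with n hl hM hsq hn
  have hlog : 0 < Real.log (Real.logb 2 n) := Real.log_pos hl
  have hlg : Real.logb 2 n / 2 ≤ Real.logb 2 (windowBound d n) := by
    have h : Real.logb 2 n ≤ Real.logb 2 (windowBound d n ^ 2) :=
      Real.logb_le_logb_of_le one_lt_two (by exact_mod_cast hn) (by exact_mod_cast hsq)
    rw [Real.logb_pow] at h
    push_cast at h
    linarith
  calc n * Real.logb 2 n / Real.logb 2 (Real.logb 2 n)
      ≤ n * Real.logb 2 n / Real.log (Real.logb 2 n) := by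
        gcongr
        exact log_le_logb_two hl.le
    _ = 32 * (d + 1) * (n / (16 * (d + 1) * Real.log (Real.logb 2 n)) * (Real.logb 2 n / 2)) := by
        field_simp; norm_num
    _ ≤ _ := by gcongr

theorem eventually_mul_exp_neg_le_one_div_rpow (K c : ℝ) : ∀ᶠ n : ℕ in atTop,
    ∀ b : ℕ, b ≤ K * Real.logb 2 n ^ d →
      b * Real.exp (-(n / (16 * b))) ≤ 1 / (n : ℝ) ^ c := by
  filter_upwards [eventually_mul_logb_two_pow_le K d,
    eventually_mul_logb_two_pow_le (16 * |c + 1| * K) (d + 1), eventually_ge_atTop 1]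
    with n hpow hpow_succ hn b hb
  have hn' : (1 : ℝ) ≤ n := by exact_mod_cast hn
  have hn0 : (0 : ℝ) < n := one_pos.trans_le hn'
  rcases b.eq_zero_or_pos with rfl | hb0
  · simp only [Nat.cast_zero, zero_mul]
    positivity
  have hexponent : (c + 1) * Real.log n ≤ n / (16 * b) := by
    have hlog := Real.log_nonneg hn'
    have hl : Real.log n ≤ Real.logb 2 n := log_le_logb_two hn'
    rw [le_div_iff₀ (by positivity)]
    calc (c + 1) * Real.log n * (16 * b)
        ≤ |c + 1| * Real.logb 2 n * (16 * (K * Real.logb 2 n ^ d)) := by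
          gcongr
          · exact mul_nonneg (abs_nonneg _) (hlog.trans hl)
          · exact le_abs_self _
      _ = 16 * |c + 1| * K * Real.logb 2 n ^ (d + 1) := by ring
      _ ≤ n := hpow_succ
  calc b * Real.exp (-(n / (16 * b))) ≤ n * Real.exp (-((c + 1) * Real.log n)) := by
        gcongr
        exact_mod_cast hb.trans hpow
    _ = 1 / (n : ℝ) ^ c := by
        rw [Real.rpow_def_of_pos hn0, one_div, ← Real.exp_neg]
        nth_rewrite 1 [← Real.exp_log hn0]
        rw [← Real.exp_add]
        ring_nf

end Asymptotics

end LogBackoff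

theorem mainTheorem3_general {w : ℕ → ℕ+} (hw : LogBackoff.GrowsSlowly w) :
    ∃ C : ℝ, 0 < C ∧ ∀ c : ℝ, ∀ᶠ n : ℕ in atTop,
      1 - 1 / (n : ℝ) ^ c ≤
        (LogBackoff.choiceLaw w n).real
          {x | ENNReal.ofReal (C * (n * Real.logb 2 n / Real.logb 2 (Real.logb 2 n))) ≤
            LogBackoff.collisions x} := by
  obtain ⟨d, K, κ, hκ, hw⟩ := hw
  refine ⟨κ / (64 * (d + 1)), by positivity, fun c => ?_⟩
  have hM_atTop := LogBackoff.tendsto_windowBound_atTop d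
  filter_upwards [hM_atTop.eventually hw, hM_atTop.eventually_ge_atTop 1,
    LogBackoff.eventually_windowBound_le d,
    LogBackoff.eventually_mul_logb_two_pow_le_exp d (4 * Real.exp 1 * K),
    LogBackoff.eventually_mul_exp_neg_le_one_div_rpow d K c,
    LogBackoff.eventually_mul_logb_two_div_le d]
    with n ⟨b, hwM, hb, hsum⟩ hM hMn hload hfail hcount
  set M := LogBackoff.windowBound d n
  have hbn : b ≤ K * Real.logb 2 n ^ d := by
    have hM0 : 0 ≤ Real.logb 2 M := Real.logb_nonneg one_lt_two (by exact_mod_cast hM)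
    exact hb.trans (by gcongr; exact one_lt_two)
  have hslots : κ / (64 * (d + 1)) * (n * Real.logb 2 n / Real.logb 2 (Real.logb 2 n))
      ≤ (∑ i ∈ Finset.range b, ((w i : ℕ) : ℝ)) / 2 := by
    calc _ ≤ κ / (64 * (d + 1)) * (32 * (d + 1) * (M * Real.logb 2 M)) := by gcongr
      _ = κ * (M * Real.logb 2 M) / 2 := by field_simp; ring
      _ ≤ _ := by gcongr
  calc 1 - 1 / (n : ℝ) ^ c ≤ 1 - b * Real.exp (-(n / (16 * b))) := by gcongr; exact hfail b hbn
    _ ≤ _ := LogBackoff.one_sub_le_choiceLaw_real_half_sum_le_collisions hMn hwM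
        (le_trans (by rw [mul_assoc _ (K : ℝ)]; gcongr) hload)
    _ ≤ _ := measureReal_mono fun x hx => (ENNReal.ofReal_le_ofReal hslots).trans hx

theorem mainTheorem3 (w : ℕ → ℕ+)
    (hw : w = LogBackoff.doublingSchedule ∨ w = LogBackoff.monotoneSchedule) :
    ∃ C : ℝ, 0 < C ∧ ∀ c : ℝ, 1 < c → ∀ᶠ n : ℕ in atTop,
      1 - 1 / (n : ℝ) ^ c ≤
        (LogBackoff.choiceLaw w n).real
          {x | ENNReal.ofReal (C * (n * Real.logb 2 n / Real.logb 2 (Real.logb 2 n))) ≤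
            LogBackoff.collisions x} := by
  have hslow : LogBackoff.GrowsSlowly w := by
    rcases hw with rfl | rfl
    exacts [LogBackoff.growsSlowly_doublingSchedule, LogBackoff.growsSlowly_monotoneSchedule]
  exact (mainTheorem3_general hslow).imp fun _ hC => ⟨hC.1, fun c _ => hC.2 c⟩
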